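/- **Theorem (Poisson mixture estimation).** For a probability distribution $G$ on $\mathbb{R}_+=[0,\infty)$ let $f_G(y)=\int \frac{e^{-\theta}\theta^y}{y!}\,G(d\theta)$, $y\in\mathbb{Z}_+=\{0,1,2,\ldots\}$, be the Poisson mixture with mixing distribution $G$. For a class $\mathcal{G}$ of such distributions define the minimax squared Hellinger risk $$R_n(\mathcal{G})=\inf_{\hat f}\ \sup_{G\in\mathcal{G}}\ \mathbb{E}_G\big[H^2(f_G,\hat f)\big],\qquad H^2(f,g)=\sum_{y\in\mathbb{Z}_+}\big(\sqrt{f(y)}-\sqrt{g(y)}\big)^2,$$ where the infimum is over all estimators $\hat f=\hat f(Y_1,\ldots,Y_n)$ whose values are probability mass functions on $\mathbb{Z}_+$, and $Y_1,\ldots,Y_n$ are i.i.d. with law $f_G$ under $\mathbb{E}_G$. Let $\mathcal{P}([0,h])$ be the set of all probability distributions on $[0,h]$, and let $\mathsf{SubE}(s)$ be the set of all probability distributions $G$ on $\mathbb{R}_+$ with $G([t,\infty))\le 2e^{-t/s}$ for all $t>0$. 1. (Compactly supported case.) For any $h>0$ there exist constants $c_0=c_0(h)>0$ and $n_0$ such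 that for all $n\ge n_0$, $$R_n(\mathcal{P}([0,h]))\ \ge\ \frac{c_0}{n}\,\frac{\log n}{\log\log n}.$$ 2. (Subexponential case.) For any $s>0$ there exist constants $c_1=c_1(s)>0$ and $n_0$ such that for all $n\ge n_0$, $$R_n(\mathsf{SubE}(s))\ \ge\ \frac{c_1}{n}\,\log n.$$ -/

import Mathlib

open MeasureTheory ProbabilityTheory
open scoped NNReal ENNReal

namespace PoissonMixture

/-- The Poisson probability mass function `θ ↦ f_θ(y)` is measurable in the parameter. -/
theorem measurable_poissonMeasure_singleton (y : ℕ) :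
    Measurable fun θ : ℝ≥0 => poissonMeasure θ {y} := by
  simp only [poissonMeasure_singleton]
  fun_prop

/-- The mixture density `f_G(y) = ∫ f_θ(y) G(dθ)`, with `f_θ(y) = e^{-θ} θ^y / y!`, of a mixing
distribution `G` on `ℝ₊`, as a probability mass function on `ℕ`. -/
noncomputable def mixture (G : ProbabilityMeasure ℝ≥0) : PMF ℕ :=
  ⟨fun y => ∫⁻ θ, poissonMeasure θ {y} ∂(G : Measure ℝ≥0), by
    have h : ∑' y : ℕ, ∫⁻ θ, poissonMeasure θ {y} ∂(G : Measure ℝ≥0) = 1 := by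
      rw [← lintegral_tsum fun y => (measurable_poissonMeasure_singleton y).aemeasurable]
      have h1 : ∀ θ : ℝ≥0, ∑' y : ℕ, poissonMeasure θ {y} = 1 := fun θ =>
        (poissonMeasure θ).toPMF.tsum_coe
      simp [h1]
    exact h ▸ ENNReal.summable.hasSum⟩

/-- The law of an i.i.d. sample `Y₁, …, Yₙ` from the mixture `f_G`. -/
noncomputable def sampleLaw (n : ℕ) (G : ProbabilityMeasure ℝ≥0) : Measure (Fin n → ℕ) :=
  Measure.pi fun _ => (mixture G).toMeasure

/-- The squared Hellinger distance `H²(p, q) = ∑ y, (√p(y) - √q(y))²` of two densities with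
respect to the counting measure on `ℕ`. -/
noncomputable def hellingerSq (p q : PMF ℕ) : ℝ≥0∞ :=
  ∑' y, ENNReal.ofReal ((√(p y).toReal - √(q y).toReal) ^ 2)

/-- The minimax squared Hellinger risk
`R_n(𝒢) = inf_{f̂} sup_{G ∈ 𝒢} E_G[H²(f_G, f̂(Y₁, …, Yₙ))]`. The infimum is over all density
estimators; the sample space is countable and discrete, so every map on it is measurable. -/
noncomputable def minimaxRisk (n : ℕ) (𝒢 : Set (ProbabilityMeasure ℝ≥0)) : ℝ≥0∞ :=
  ⨅ f : (Fin n → ℕ) → PMF ℕ, ⨆ G ∈ 𝒢,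
    ∫⁻ Y, hellingerSq (mixture G) (f Y) ∂(sampleLaw n G)

/-- The probability distributions on `[0, h]`. -/
def priorsOnIcc (h : ℝ) : Set (ProbabilityMeasure ℝ≥0) :=
  {G | (G : Measure ℝ≥0) {θ | (θ : ℝ) ≤ h} = 1}

/-- The `s`-subexponential distributions on `ℝ₊`: `G([t, ∞)) ≤ 2 e^{-t/s}` for all `t > 0`. -/
def subExp (s : ℝ) : Set (ProbabilityMeasure ℝ≥0) :=
  {G | ∀ t : ℝ, 0 < t →
    (G : Measure ℝ≥0) {θ | t ≤ (θ : ℝ)} ≤ ENNReal.ofReal (2 * Real.exp (-t / s))}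

end PoissonMixture

/-!
The lower bound comes from a hypercube of priors whose mixtures can be moved one point `y` at a
time.

Take the nodes `k / b` for `1 ≤ k ≤ m = 8 J`, together with the origin. Up to the factor
`exp (-θ)`, the mixture value at `y ≥ 1` is a scaled `y`-th moment of the prior. The coefficients
of the Lagrange polynomials at the integers `0, …, m` give signed weights on the nodes for which
all moments of order `1, …, m` vanish except the `j`-th one, and these weights grow only like
`C ^ m` after scaling by `j!` (`exists_dual_weights`). The origin absorbs the change of mass,
since the Poisson law with parameter `0` sits at `y = 0`. So for small shifts `τ 1, …, τ J` there
is a prior with mixture `F j + τ j` at `1 ≤ j ≤ J`, unperturbed mixture `F y` at `J < y ≤ 8 J`,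
and a geometrically small deviation beyond `8 J` (`exists_decoupled_priors`). The value at `y = 0`
needs no separate computation because all mixtures have total mass one.

With shifts of size `√(F j / n)`, up to a constant, flipping one shift changes the squared
Hellinger distance by order `1 / n`, both from above (`hellingerSq_le_of_localized`) and, at the
point `j` alone, from below. Assouad's lemma (`assouad_hellinger`) turns this into a risk of order
`J / n`. The construction works when `b` exceeds an absolute constant and
`b ^ (4 J) ≤ n ≤ b ^ (12 J)`, so `J` may be taken of order `log n / log b`
(`log_div_log_le_minimaxRisk`).

The nodes lie in `[0, 8 J / b]`. For distributions on `[0, h]`, take `b = log n`, so that the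
nodes are bounded by `2 / log log n`. For subexponential distributions, a large constant `b`
suffices: the mass away from the origin is at most `2 * 3 ^ (-m)`, below the allowed tail
`2 exp (-t / s)` for every `t ≤ m / b`.
-/

namespace PoissonMixture

/-! ### Two-point and hypercube lower bounds in Hellinger distance -/

/-- Sums of product functions over a finite power factorize. -/
theorem tsum_pi_prod {α : Type*} (n : ℕ) (g : α → ℝ≥0∞) :
    ∑' Y : Fin n → α, ∏ i, g (Y i) = (∑' y, g y) ^ n := by
  induction n with
  | zero => simp
  | succ n ih =>
    rw [← (Fin.consEquiv fun _ => α).tsum_eq, pow_succ', ← ih,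
      ENNReal.tsum_prod' (f := fun p : α × (Fin n → α) =>
        ∏ i, g ((Fin.consEquiv fun _ => α) p i)), ← ENNReal.tsum_mul_right]
    refine tsum_congr fun y => ?_
    rw [← ENNReal.tsum_mul_left]
    refine tsum_congr fun Y => ?_
    simp [Fin.consEquiv, Fin.prod_univ_succ]

/-- Integration against an i.i.d. sample from a probability mass function is a weighted sum. -/
theorem lintegral_pi_toMeasure (n : ℕ) (p : PMF ℕ) (F : (Fin n → ℕ) → ℝ≥0∞) :
    ∫⁻ Y, F Y ∂(Measure.pi fun _ : Fin n => p.toMeasure) = ∑' Y, F Y * ∏ i, p (Y i) := by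
  rw [lintegral_countable']
  refine tsum_congr fun Y => ?_
  rw [Measure.pi_singleton]
  simp_rw [PMF.toMeasure_apply_singleton _ _ (MeasurableSet.singleton _)]

/-- The Bhattacharyya coefficient is `1 - H² / 2`. -/
theorem hellingerSq_add_two_mul_tsum_sqrt (p q : PMF ℕ) :
    hellingerSq p q + 2 * ∑' y, ENNReal.ofReal (√(p y).toReal * √(q y).toReal) = 2 := by
  have key : ∀ y, ENNReal.ofReal ((√(p y).toReal - √(q y).toReal) ^ 2)
      + 2 * ENNReal.ofReal (√(p y).toReal * √(q y).toReal) = p y + q y := by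
    intro y
    rw [show (2 : ℝ≥0∞) = ENNReal.ofReal 2 by simp, ← ENNReal.ofReal_mul (by norm_num),
      ← ENNReal.ofReal_add (by positivity) (by positivity)]
    conv_rhs => rw [← ENNReal.ofReal_toReal (p.apply_ne_top y),
      ← ENNReal.ofReal_toReal (q.apply_ne_top y),
      ← ENNReal.ofReal_add ENNReal.toReal_nonneg ENNReal.toReal_nonneg]
    congr 1
    have hp := Real.sq_sqrt (ENNReal.toReal_nonneg (a := p y))
    have hq := Real.sq_sqrt (ENNReal.toReal_nonneg (a := q y))
    linear_combination hp + hq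
  rw [hellingerSq, ← ENNReal.tsum_mul_left, ← ENNReal.tsum_add]
  simp_rw [key]
  rw [ENNReal.tsum_add, p.tsum_coe, q.tsum_coe]
  norm_num

/-- The weighted arithmetic-geometric mean inequality `√(xz) ≤ 2 min(x, z) + (x + z) / 8`. -/
theorem sqrt_mul_sqrt_le_min_add {x z : ℝ} (hx : 0 ≤ x) (hz : 0 ≤ z) :
    √x * √z ≤ 2 * min x z + (x + z) / 8 := by
  have h1 := Real.sq_sqrt hx
  have h2 := Real.sq_sqrt hz
  rcases le_total x z with h | h
  · rw [min_eq_left h]; nlinarith [sq_nonneg (4 * √x - √z)]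
  · rw [min_eq_right h]; nlinarith [sq_nonneg (4 * √z - √x)]

/-- If two densities are within squared Hellinger distance `1 / n`, then their `n`-fold products
overlap: the mass of the minimum of the product densities is at least `1 / 8`. -/
theorem one_eighth_le_tsum_min {n : ℕ} (hn : 1 ≤ n) {p q : PMF ℕ}
    (h : hellingerSq p q ≤ ENNReal.ofReal (1 / n)) :
    1 / 8 ≤ ∑' Y : Fin n → ℕ, min (∏ i, p (Y i)) (∏ i, q (Y i)) := by
  set B := ∑' y, ENNReal.ofReal (√(p y).toReal * √(q y).toReal) with hB
  have hn' : (1 : ℝ) ≤ n := by exact_mod_cast hn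
  have hsum := hellingerSq_add_two_mul_tsum_sqrt p q
  rw [← hB] at hsum
  have hBtop : B ≠ ∞ := by
    intro h0
    rw [h0] at hsum
    simp at hsum
  -- `B ≥ 1 - 1 / (2n)`, so that `B ^ n ≥ 1 / 2` by Bernoulli's inequality.
  have hB1 : 1 - 1 / (2 * n) ≤ B.toReal := by
    have h2 : (2 : ℝ≥0∞) ≤ ENNReal.ofReal (1 / n) + 2 * B := by
      exact hsum.symm.le.trans (by gcongr)
    have h3 := ENNReal.toReal_mono (by finiteness) h2
    rw [ENNReal.toReal_add (by finiteness) (by finiteness), ENNReal.toReal_mul,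
      ENNReal.toReal_ofReal (by positivity)] at h3
    simp only [ENNReal.toReal_ofNat] at h3
    have : (1 : ℝ) / (2 * n) = 1 / n / 2 := by field_simp
    linarith
  have hBn : 1 / 2 ≤ B.toReal ^ n := by
    have h1 : (1 : ℝ) / (2 * n) ≤ 1 := by
      rw [div_le_one (by positivity)]; linarith
    have h4 := one_add_mul_le_pow (a := -(1 / (2 * n) : ℝ)) (by linarith) n
    have h5 : (n : ℝ) * -(1 / (2 * n)) = -(1 / 2) := by field_simp
    have h6 : (1 + -(1 / (2 * n) : ℝ)) ^ n ≤ B.toReal ^ n :=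
      pow_le_pow_left₀ (by linarith) (by linarith) n
    linarith
  have hpt : ∀ Y : Fin n → ℕ, ∏ i, ENNReal.ofReal (√(p (Y i)).toReal * √(q (Y i)).toReal) ≤
      2 * min (∏ i, p (Y i)) (∏ i, q (Y i)) + 8⁻¹ * (∏ i, p (Y i) + ∏ i, q (Y i)) := by
    intro Y
    have e : ∀ r : PMF ℕ, ∏ i, r (Y i) = ENNReal.ofReal (∏ i, (r (Y i)).toReal) := fun r => by
      rw [ENNReal.ofReal_prod_of_nonneg fun i _ => ENNReal.toReal_nonneg]
      exact Finset.prod_congr rfl fun i _ => (ENNReal.ofReal_toReal (r.apply_ne_top _)).symm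
    have hx : ∀ r : PMF ℕ, 0 ≤ ∏ i, (r (Y i)).toReal := fun r =>
      Finset.prod_nonneg fun i _ => ENNReal.toReal_nonneg
    have hs : ∀ r : PMF ℕ, ∏ i, √(r (Y i)).toReal = √(∏ i, (r (Y i)).toReal) := fun r => by
      rw [Real.sqrt_prod _ fun i _ => ENNReal.toReal_nonneg]
    rw [e p, e q, ← ENNReal.ofReal_prod_of_nonneg fun i _ => by positivity,
      Finset.prod_mul_distrib, hs, hs, ← ENNReal.ofReal_min, ← ENNReal.ofReal_add (hx p) (hx q),
      show (2 : ℝ≥0∞) = ENNReal.ofReal 2 by simp,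
      show (8⁻¹ : ℝ≥0∞) = ENNReal.ofReal 8⁻¹ by
        rw [ENNReal.ofReal_inv_of_pos (by norm_num)]; simp,
      ← ENNReal.ofReal_mul (by norm_num), ← ENNReal.ofReal_mul (by norm_num),
      ← ENNReal.ofReal_add (mul_nonneg (by norm_num) (le_min (hx p) (hx q)))
        (mul_nonneg (by norm_num) (add_nonneg (hx p) (hx q)))]
    apply ENNReal.ofReal_le_ofReal
    have := sqrt_mul_sqrt_le_min_add (hx p) (hx q)
    linarith
  set S := ∑' Y : Fin n → ℕ, min (∏ i, p (Y i)) (∏ i, q (Y i)) with hS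
  have htot : B ^ n ≤ 2 * S + 8⁻¹ * (1 + 1) := by
    rw [hB, ← tsum_pi_prod]
    refine (ENNReal.tsum_le_tsum hpt).trans ?_
    rw [ENNReal.tsum_add, ENNReal.tsum_mul_left, ENNReal.tsum_mul_left, ENNReal.tsum_add,
      tsum_pi_prod, tsum_pi_prod, p.tsum_coe, q.tsum_coe, one_pow]
  by_cases hStop : S = ∞
  · rw [hStop]; exact le_top
  have h7 := ENNReal.toReal_mono (by finiteness) htot
  rw [ENNReal.toReal_add (by finiteness) (by finiteness), ENNReal.toReal_mul,
    ENNReal.toReal_pow] at h7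
  rw [← ENNReal.ofReal_toReal hStop, ← ENNReal.toReal_le_toReal (by finiteness) (by finiteness)]
  have h8 : ((8 : ℝ≥0∞)⁻¹ * (1 + 1)).toReal = 1 / 4 := by
    rw [ENNReal.toReal_mul, ENNReal.toReal_inv, ENNReal.toReal_add (by simp) (by simp)]
    norm_num
  rw [h8] at h7
  simp only [ENNReal.toReal_ofNat] at h7
  rw [ENNReal.toReal_ofReal ENNReal.toReal_nonneg]
  simp only [one_div, ENNReal.toReal_inv, ENNReal.toReal_ofNat]
  linarith

/-- The expected squared error, under an i.i.d. sample of size `n` from `p`, of an estimator of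
the number `√(p y)`. -/
noncomputable def coordRisk (n : ℕ) (p : PMF ℕ) (y : ℕ) (g : (Fin n → ℕ) → ℝ) : ℝ≥0∞ :=
  ∫⁻ Y, ENNReal.ofReal ((√(p y).toReal - g Y) ^ 2) ∂(Measure.pi fun _ : Fin n => p.toMeasure)

/-- Le Cam's two-point bound for a single coordinate. -/
theorem le_coordRisk_add {n : ℕ} (hn : 1 ≤ n) {p q : PMF ℕ}
    (h : hellingerSq p q ≤ ENNReal.ofReal (1 / n)) {y : ℕ} {ε : ℝ} (hε : 0 ≤ ε)
    (hsep : ε ≤ (√(p y).toReal - √(q y).toReal) ^ 2) (g : (Fin n → ℕ) → ℝ) :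
    ENNReal.ofReal (ε / 16) ≤ coordRisk n p y g + coordRisk n q y g := by
  simp_rw [coordRisk, lintegral_pi_toMeasure]
  rw [← ENNReal.tsum_add]
  calc ENNReal.ofReal (ε / 16) = ENNReal.ofReal (ε / 2) * (1 / 8) := by
        rw [show (1 / 8 : ℝ≥0∞) = ENNReal.ofReal (1 / 8) by
          rw [ENNReal.ofReal_div_of_pos (by norm_num)]; simp,
          ← ENNReal.ofReal_mul (by positivity)]
        congr 1; ring
    _ ≤ ENNReal.ofReal (ε / 2) * ∑' Y : Fin n → ℕ, min (∏ i, p (Y i)) (∏ i, q (Y i)) := by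
        gcongr; exact one_eighth_le_tsum_min hn h
    _ ≤ _ := by
        rw [← ENNReal.tsum_mul_left]
        refine ENNReal.tsum_le_tsum fun Y => ?_
        have h1 : ENNReal.ofReal (ε / 2) ≤ ENNReal.ofReal ((√(p y).toReal - g Y) ^ 2)
            + ENNReal.ofReal ((√(q y).toReal - g Y) ^ 2) := by
          rw [← ENNReal.ofReal_add (by positivity) (by positivity)]
          apply ENNReal.ofReal_le_ofReal
          nlinarith [sq_nonneg ((√(p y).toReal - g Y) + (√(q y).toReal - g Y))]
        calc _ ≤ (ENNReal.ofReal ((√(p y).toReal - g Y) ^ 2)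
              + ENNReal.ofReal ((√(q y).toReal - g Y) ^ 2)) *
                min (∏ i, p (Y i)) (∏ i, q (Y i)) := by gcongr
          _ ≤ _ := by
            rw [add_mul]
            gcongr
            · exact min_le_left _ _
            · exact min_le_right _ _

/-- The vertex of the hypercube obtained by flipping one coordinate. -/
def flipAt {J : ℕ} (u : Fin J → Bool) (i : Fin J) : Fin J → Bool := Function.update u i (!u i)

theorem flipAt_involutive {J : ℕ} (i : Fin J) :
    Function.Involutive fun u : Fin J → Bool => flipAt u i := by
  intro u
  simp [flipAt]

/-- **Assouad's lemma** for the squared Hellinger loss. If densities indexed by the hypercube are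
within squared distance `1 / n` for neighbouring vertices, and flipping the `i`-th coordinate
moves `√p` at the point `y i` by at least `√ε`, then every estimator has squared Hellinger risk at
least `J ε / 32` at some vertex. -/
theorem assouad_hellinger {n J : ℕ} (hn : 1 ≤ n) (P : (Fin J → Bool) → PMF ℕ) {y : Fin J → ℕ}
    (hy : Function.Injective y) {ε : ℝ} (hε : 0 ≤ ε)
    (hclose : ∀ u i, hellingerSq (P u) (P (flipAt u i)) ≤ ENNReal.ofReal (1 / n))
    (hsep : ∀ u i, ε ≤ (√(P u (y i)).toReal - √(P (flipAt u i) (y i)).toReal) ^ 2)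
    (f : (Fin n → ℕ) → PMF ℕ) :
    ENNReal.ofReal (J * ε / 32) ≤
      ⨆ u, ∫⁻ Y, hellingerSq (P u) (f Y) ∂(Measure.pi fun _ : Fin n => (P u).toMeasure) := by
  set R : (Fin J → Bool) → ℝ≥0∞ := fun u =>
    ∫⁻ Y, hellingerSq (P u) (f Y) ∂(Measure.pi fun _ : Fin n => (P u).toMeasure) with hR
  set r : (Fin J → Bool) → Fin J → ℝ≥0∞ := fun u i =>
    coordRisk n (P u) (y i) fun Y => √(f Y (y i)).toReal with hr
  have hRr : ∀ u, ∑ i, r u i ≤ R u := by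
    intro u
    simp only [hr, hR, coordRisk]
    rw [← lintegral_finsetSum' _ fun i _ => (measurable_of_countable _).aemeasurable]
    refine lintegral_mono fun Y => ?_
    rw [hellingerSq, ← tsum_fintype (L := SummationFilter.unconditional _)]
    exact ENNReal.tsum_comp_le_tsum_of_injective hy
      fun k => ENNReal.ofReal ((√(P u k).toReal - √(f Y k).toReal) ^ 2)
  have hpair : ∀ i, 2 ^ J * ENNReal.ofReal (ε / 16) ≤ 2 * ∑ u, r u i := by
    intro i
    have hflip : ∑ u, r (flipAt u i) i = ∑ u, r u i :=
      Equiv.sum_comp (flipAt_involutive i).toPerm (fun u => r u i)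
    calc 2 ^ J * ENNReal.ofReal (ε / 16) = ∑ _u : Fin J → Bool, ENNReal.ofReal (ε / 16) := by
          simp
      _ ≤ ∑ u, (r u i + r (flipAt u i) i) :=
          Finset.sum_le_sum fun u _ => le_coordRisk_add hn (hclose u i) hε (hsep u i) _
      _ = 2 * ∑ u, r u i := by rw [Finset.sum_add_distrib, hflip, two_mul]
  have h1 : (J : ℝ≥0∞) * (2 ^ J * ENNReal.ofReal (ε / 16)) ≤ 2 * (2 ^ J * ⨆ u, R u) := by
    calc (J : ℝ≥0∞) * (2 ^ J * ENNReal.ofReal (ε / 16))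
        = ∑ _i : Fin J, 2 ^ J * ENNReal.ofReal (ε / 16) := by simp
      _ ≤ ∑ i, 2 * ∑ u, r u i := Finset.sum_le_sum fun i _ => hpair i
      _ = 2 * ∑ u, ∑ i, r u i := by rw [← Finset.mul_sum, Finset.sum_comm]
      _ ≤ 2 * ∑ _u : Fin J → Bool, ⨆ u, R u := by
          gcongr with u
          exact (hRr u).trans (le_iSup R u)
      _ = _ := by simp
  have h2 : (2 * 2 ^ J : ℝ≥0∞) * ENNReal.ofReal (J * ε / 32) ≤ (2 * 2 ^ J) * ⨆ u, R u := by
    refine le_trans (le_of_eq ?_) (h1.trans_eq (mul_assoc _ _ _).symm)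
    rw [show (J * ε / 32 : ℝ) = J * (ε / 16) / 2 by ring,
      ENNReal.ofReal_div_of_pos (by norm_num), ENNReal.ofReal_mul (by positivity),
      ENNReal.ofReal_natCast, ENNReal.ofReal_ofNat, mul_comm (2 : ℝ≥0∞), mul_assoc,
      ENNReal.mul_div_cancel (by norm_num) (by norm_num)]
    ring
  exact (ENNReal.mul_le_mul_iff_right (by simp) (by finiteness)).1 h2

/-! ### Dual weights for the Poisson moments at lattice nodes -/

/-- The coefficients of a monic real polynomial with prescribed roots are dominated by the value
at `x ≥ 0` of the polynomial with roots of the same modulus on the negative axis. -/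
theorem abs_coeff_prod_X_sub_C_mul_pow_le {ι : Type*} (s : Finset ι) (r : ι → ℝ) {x : ℝ}
    (hx : 0 ≤ x) (j : ℕ) :
    |(∏ i ∈ s, (Polynomial.X - Polynomial.C (r i))).coeff j| * x ^ j ≤ ∏ i ∈ s, (x + |r i|) := by
  classical
  induction s using Finset.induction_on generalizing j with
  | empty =>
    rcases j with _ | j
    · simp
    · simp [Polynomial.coeff_one]
  | insert i s hi ih =>
    rw [Finset.prod_insert hi, Finset.prod_insert hi, sub_mul, Polynomial.coeff_sub,
      Polynomial.coeff_C_mul]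
    set M := ∏ i ∈ s, (x + |r i|)
    set p := ∏ i ∈ s, (Polynomial.X - Polynomial.C (r i))
    rcases j with _ | j
    · have h0 := ih 0
      have hM : 0 ≤ M := (by positivity : (0 : ℝ) ≤ _).trans h0
      simp only [Polynomial.mul_coeff_zero, Polynomial.coeff_X_zero, zero_mul, zero_sub, abs_neg,
        abs_mul, pow_zero, mul_one] at h0 ⊢
      nlinarith [abs_nonneg (r i)]
    · rw [Polynomial.coeff_X_mul]
      have h0 := mul_le_mul_of_nonneg_left (ih j) hx
      have h1 := mul_le_mul_of_nonneg_left (ih (j + 1)) (abs_nonneg (r i))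
      have h2 := abs_sub (p.coeff j) (r i * p.coeff (j + 1))
      rw [abs_mul] at h2
      calc _ ≤ (|p.coeff j| + |r i| * |p.coeff (j + 1)|) * x ^ (j + 1) := by gcongr
        _ = x * (|p.coeff j| * x ^ j) + |r i| * (|p.coeff (j + 1)| * x ^ (j + 1)) := by ring
        _ ≤ _ := by linarith

theorem prod_abs_sub_range_erase {m k : ℕ} (hk : k ≤ m) :
    ∏ l ∈ (Finset.range (m + 1)).erase k, |(k : ℝ) - l| = k.factorial * (m - k).factorial := by
  have hs : (Finset.range (m + 1)).erase k = Finset.range k ∪ Finset.Ico (k + 1) (m + 1) := by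
    ext l; simp; omega
  have hd : Disjoint (Finset.range k) (Finset.Ico (k + 1) (m + 1)) := by
    rw [Finset.disjoint_left]; intro l; simp; omega
  rw [hs, Finset.prod_union hd, Finset.prod_Ico_eq_prod_range]
  congr 1
  · rw [← Finset.prod_range_reflect, ← Finset.prod_range_add_one_eq_factorial]
    push_cast
    refine Finset.prod_congr rfl fun l hl => ?_
    have hl' : l + 1 ≤ k := by simpa using hl
    have h0 : (0 : ℝ) ≤ l := by positivity
    rw [show k - 1 - l = k - (l + 1) by omega, Nat.cast_sub hl', abs_of_nonneg (by
      push_cast; linarith)]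
    push_cast
    ring
  · rw [← Finset.prod_range_add_one_eq_factorial, show m + 1 - (k + 1) = m - k by omega]
    push_cast
    refine Finset.prod_congr rfl fun l _ => ?_
    have h0 : (0 : ℝ) ≤ l := by positivity
    rw [abs_of_nonpos (by linarith)]
    ring

theorem exp_natCast_le_three_pow (m : ℕ) : Real.exp m ≤ 3 ^ m := by
  rw [← Real.exp_one_pow]
  exact pow_le_pow_left₀ (Real.exp_pos 1).le Real.exp_one_lt_three.le m

/-- The factorially scaled coefficients of the Lagrange polynomials at the nodes `0, …, m` grow at
most geometrically in `m`. -/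
theorem abs_factorial_mul_coeff_lagrange_le {m k j : ℕ} (hk : k ≤ m) (hj : j ≤ m) (hm : 1 ≤ m) :
    |j.factorial * (Lagrange.basis (Finset.range (m + 1)) (fun l : ℕ => (l : ℝ)) k).coeff j| ≤
      12 ^ m := by
  set s := (Finset.range (m + 1)).erase k with hs
  have hm0 : (0 : ℝ) < m := by exact_mod_cast hm
  have hcoeff : (Lagrange.basis (Finset.range (m + 1)) (fun l : ℕ => (l : ℝ)) k).coeff j =
      (∏ l ∈ s, ((k : ℝ) - l))⁻¹ *
        (∏ l ∈ s, (Polynomial.X - Polynomial.C (l : ℝ))).coeff j := by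
    simp only [Lagrange.basis, Lagrange.basisDivisor, Finset.prod_mul_distrib]
    rw [← map_prod, Polynomial.coeff_C_mul, Finset.prod_inv_distrib]
  have hden : |(∏ l ∈ s, ((k : ℝ) - l))| = k.factorial * (m - k).factorial := by
    rw [Finset.abs_prod, prod_abs_sub_range_erase hk]
  -- Evaluate the coefficient bound at `x = m`, where `j! ≤ m ^ j`.
  have hnum : |(∏ l ∈ s, (Polynomial.X - Polynomial.C (l : ℝ))).coeff j| * (j.factorial : ℝ) ≤
      (2 * m : ℝ) ^ m := by
    have h1 := abs_coeff_prod_X_sub_C_mul_pow_le s (fun l : ℕ => (l : ℝ)) hm0.le j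
    have h2 : (j.factorial : ℝ) ≤ (m : ℝ) ^ j := by
      exact_mod_cast (Nat.factorial_le_pow j).trans (Nat.pow_le_pow_left hj j)
    have h3 : ∏ l ∈ s, ((m : ℝ) + |(l : ℝ)|) ≤ ∏ _l ∈ s, (2 * m : ℝ) := by
      refine Finset.prod_le_prod (fun l _ => by positivity) fun l hl => ?_
      have : l ≤ m := by
        have := (Finset.mem_erase.1 hl).2; simp at this; omega
      have : (l : ℝ) ≤ m := by exact_mod_cast this
      rw [abs_of_nonneg (by positivity)]; linarith
    have hcard : s.card = m := by
      rw [hs, Finset.card_erase_of_mem (by simp; omega)]; simp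
    rw [Finset.prod_const, hcard] at h3
    calc _ ≤ |(∏ l ∈ s, (Polynomial.X - Polynomial.C (l : ℝ))).coeff j| * (m : ℝ) ^ j := by
          gcongr
      _ ≤ _ := h1.trans h3
  have hchoose : (m.factorial : ℝ) ≤ 2 ^ m * (k.factorial * (m - k).factorial) := by
    have h1 := Nat.choose_mul_factorial_mul_factorial hk
    have h2 := Nat.choose_le_two_pow m k
    have : m.factorial ≤ 2 ^ m * (k.factorial * (m - k).factorial) := by
      rw [← h1, mul_assoc]; exact Nat.mul_le_mul_right _ h2
    exact_mod_cast this
  have hpow : (m : ℝ) ^ m ≤ 3 ^ m * m.factorial := by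
    have h1 := Real.pow_div_factorial_le_exp (m : ℝ) hm0.le m
    rw [div_le_iff₀ (by positivity)] at h1
    exact h1.trans (by gcongr; exact exp_natCast_le_three_pow m)
  have hpos : (0 : ℝ) < k.factorial * (m - k).factorial := by positivity
  rw [hcoeff, abs_mul, abs_mul, abs_inv, hden, Nat.abs_cast]
  rw [show ∀ a b c : ℝ, a * (b⁻¹ * c) = (c * a) / b by intros; field_simp,
    div_le_iff₀ hpos]
  calc _ ≤ (2 * m : ℝ) ^ m := hnum
    _ = 2 ^ m * (m : ℝ) ^ m := mul_pow _ _ _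
    _ ≤ 2 ^ m * (3 ^ m * (2 ^ m * (k.factorial * (m - k).factorial))) := by
        gcongr
        exact hpow.trans (by gcongr)
    _ = (2 * 3 * 2) ^ m * (k.factorial * (m - k).factorial) := by
        rw [mul_pow, mul_pow]; ring
    _ = _ := by norm_num

/-- There are signed weights on the nodes `1, …, m`, of size `12 ^ m`, whose scaled moments
`∑ d(k, j) k ^ y / y!` of order `1 ≤ y ≤ m` vanish except for the `j`-th one, which is `1`. -/
theorem exists_dual_weights {m : ℕ} (hm : 1 ≤ m) : ∃ d : ℕ → ℕ → ℝ,
    (∀ k j, k ≤ m → j ≤ m → |d k j| ≤ 12 ^ m) ∧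
    ∀ y j, 1 ≤ y → y ≤ m →
      ∑ k ∈ Finset.Icc 1 m, d k j * ((k : ℝ) ^ y / y.factorial) = if y = j then 1 else 0 := by
  refine ⟨fun k j => j.factorial *
    (Lagrange.basis (Finset.range (m + 1)) (fun l : ℕ => (l : ℝ)) k).coeff j,
    fun k j hk hj => abs_factorial_mul_coeff_lagrange_le hk hj hm, fun y j hy hym => ?_⟩
  have hinj : Set.InjOn (fun l : ℕ => (l : ℝ)) (Finset.range (m + 1) : Set ℕ) :=
    fun _ _ _ _ h => by simpa using h
  have h1 := Lagrange.eq_interpolate (f := (Polynomial.X : Polynomial ℝ) ^ y) hinj (by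
    rw [Polynomial.degree_X_pow, Finset.card_range]; exact_mod_cast Nat.lt_succ_of_le hym)
  have h2 := congrArg (fun p => Polynomial.coeff p j) h1
  simp only [Polynomial.coeff_X_pow, Lagrange.interpolate_apply, Polynomial.finsetSum_coeff,
    Polynomial.coeff_C_mul, Polynomial.eval_pow, Polynomial.eval_X] at h2
  rw [Finset.range_eq_Ico, Finset.sum_eq_sum_Ico_succ_bot (by omega)] at h2
  simp only [Nat.cast_zero, zero_pow (by omega : y ≠ 0), zero_mul, zero_add] at h2
  have hf : (y.factorial : ℝ) ≠ 0 := by positivity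
  rw [show Finset.Icc 1 m = Finset.Ico 1 (m + 1) by ext; simp]
  have h3 : ∀ k, (j.factorial : ℝ) *
      (Lagrange.basis (Finset.Ico 0 (m + 1)) (fun l : ℕ => (l : ℝ)) k).coeff j *
        ((k : ℝ) ^ y / y.factorial) = (j.factorial / y.factorial) * ((k : ℝ) ^ y *
      (Lagrange.basis (Finset.Ico 0 (m + 1)) (fun l : ℕ => (l : ℝ)) k).coeff j) := by
    intro k; ring
  simp only [Finset.range_eq_Ico, h3]
  rw [← Finset.mul_sum, ← h2]
  by_cases hjy : y = j
  · subst hjy; simp [hf]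
  · simp [hjy, Ne.symm hjy]

/-! ### Priors on a lattice and the Hellinger distance of their mixtures -/

/-- The prior with weights `c k` at the lattice points `a k`, `1 ≤ k ≤ m`, and the remaining mass
at the origin. The atom at the origin only affects the mixture at `y = 0`. -/
theorem exists_lattice_prior {a : ℝ} (ha : 0 ≤ a) (m : ℕ) (c : ℕ → ℝ)
    (hc0 : ∀ k ∈ Finset.Icc 1 m, 0 ≤ c k) (hc1 : ∑ k ∈ Finset.Icc 1 m, c k ≤ 1) :
    ∃ G : ProbabilityMeasure ℝ≥0,
      (G : Measure ℝ≥0) {θ | (θ : ℝ) ≤ a * m} = 1 ∧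
      (G : Measure ℝ≥0) {θ | 0 < (θ : ℝ)} ≤ ENNReal.ofReal (∑ k ∈ Finset.Icc 1 m, c k) ∧
      1 - ∑ k ∈ Finset.Icc 1 m, c k ≤ (mixture G 0).toReal ∧
      ∀ y, 1 ≤ y → (mixture G y).toReal =
        ∑ k ∈ Finset.Icc 1 m, c k * (Real.exp (-(a * k)) * (a * k) ^ y / y.factorial) := by
  set r : ℝ := 1 - ∑ k ∈ Finset.Icc 1 m, c k with hr
  have hr0 : 0 ≤ r := by linarith
  set θ : ℕ → ℝ≥0 := fun k => ⟨a * k, by positivity⟩ with hθ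
  set μ : Measure ℝ≥0 := ENNReal.ofReal r • Measure.dirac 0 +
    ∑ k ∈ Finset.Icc 1 m, ENNReal.ofReal (c k) • Measure.dirac (θ k) with hμ
  have hμap : ∀ s, MeasurableSet s → μ s = ENNReal.ofReal r * s.indicator 1 0 +
      ∑ k ∈ Finset.Icc 1 m, ENNReal.ofReal (c k) * s.indicator 1 (θ k) := by
    intro s hs
    simp [hμ, Measure.dirac_apply' _ hs]
  have htot : ENNReal.ofReal r + ∑ k ∈ Finset.Icc 1 m, ENNReal.ofReal (c k) = 1 := by
    rw [← ENNReal.ofReal_sum_of_nonneg hc0, ← ENNReal.ofReal_add hr0 (Finset.sum_nonneg hc0), hr]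
    simp
  have hprob : IsProbabilityMeasure μ := ⟨by rw [hμap _ MeasurableSet.univ]; simpa using htot⟩
  have hint : ∀ y, mixture ⟨μ, hprob⟩ y = ENNReal.ofReal r * poissonMeasure 0 {y} +
      ∑ k ∈ Finset.Icc 1 m, ENNReal.ofReal (c k) * poissonMeasure (θ k) {y} := by
    intro y
    change ∫⁻ t, poissonMeasure t {y} ∂μ = _
    rw [hμ, lintegral_add_measure, lintegral_finsetSum_measure, lintegral_smul_measure,
      lintegral_dirac' _ (measurable_poissonMeasure_singleton y)]
    simp [lintegral_dirac' _ (measurable_poissonMeasure_singleton y)]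
  refine ⟨⟨μ, hprob⟩, ?_, ?_, ?_, ?_⟩
  · change μ _ = 1
    rw [hμap _ (measurableSet_le (by fun_prop) (by fun_prop)), ← htot]
    congr 1
    · rw [Set.indicator_of_mem (by simp; positivity)]; simp
    · refine Finset.sum_congr rfl fun k hk => ?_
      rw [Set.indicator_of_mem]
      · simp
      · have : (k : ℝ) ≤ m := by exact_mod_cast (Finset.mem_Icc.1 hk).2
        exact mul_le_mul_of_nonneg_left this ha
  · change μ _ ≤ _
    rw [hμap _ (measurableSet_lt (by fun_prop) (by fun_prop)), Set.indicator_of_notMem (by simp),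
      mul_zero, zero_add, ENNReal.ofReal_sum_of_nonneg hc0]
    refine Finset.sum_le_sum fun k _ => ?_
    refine mul_le_of_le_one_right' ?_
    exact Set.indicator_le_self' (fun _ _ => zero_le) _
  · rw [← ENNReal.ofReal_le_iff_le_toReal (PMF.apply_ne_top _ _), hint]
    refine le_trans ?_ le_self_add
    simp [poissonMeasure_singleton]
  · intro y hy
    have h0 : ∀ k : ℕ, 0 ≤ Real.exp (-(a * k)) * (a * k) ^ y / y.factorial := fun k => by positivity
    rw [hint, ← ENNReal.toReal_ofReal
      (Finset.sum_nonneg fun k hk => mul_nonneg (hc0 k hk) (h0 k)),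
      ENNReal.ofReal_sum_of_nonneg fun k hk => mul_nonneg (hc0 k hk) (h0 k)]
    congr 1
    have hy0 : y ≠ 0 := by omega
    simp only [poissonMeasure_singleton, NNReal.coe_zero, zero_pow hy0, mul_zero, zero_div,
      ENNReal.ofReal_zero, zero_add]
    refine Finset.sum_congr rfl fun k hk => ?_
    rw [← ENNReal.ofReal_mul (hc0 k hk)]
    rfl

/-- A squared difference of square roots is controlled by the chi-square type quotient. -/
theorem sq_sqrt_sub_sqrt_le_sq_div {x z w : ℝ} (hw : 0 < w) (hx : w ≤ x) (hz : w ≤ z) :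
    (√x - √z) ^ 2 ≤ (x - z) ^ 2 / (4 * w) := by
  rw [le_div_iff₀ (by positivity)]
  have h1 := Real.sq_sqrt (hw.le.trans hx)
  have h2 := Real.sq_sqrt (hw.le.trans hz)
  have h3 : √w ≤ √x := Real.sqrt_le_sqrt hx
  have h4 : √w ≤ √z := Real.sqrt_le_sqrt hz
  have h5 := Real.sq_sqrt hw.le
  have h6 : 4 * w ≤ (√x + √z) ^ 2 := by
    have := Real.sqrt_nonneg w
    calc 4 * w = (√w + √w) ^ 2 := by linear_combination -4 * h5
      _ ≤ _ := by gcongr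
  calc (√x - √z) ^ 2 * (4 * w) ≤ (√x - √z) ^ 2 * (√x + √z) ^ 2 := by gcongr
    _ = (√x ^ 2 - √z ^ 2) ^ 2 := by ring
    _ = _ := by rw [h1, h2]

theorem sq_sqrt_sub_sqrt_le_abs {x z : ℝ} (hx : 0 ≤ x) (hz : 0 ≤ z) :
    (√x - √z) ^ 2 ≤ |x - z| := by
  have h1 := Real.sq_sqrt hx
  have h2 := Real.sq_sqrt hz
  have h3 := Real.sqrt_nonneg x
  have h4 := Real.sqrt_nonneg z
  rw [← sq_abs, sq]
  calc |√x - √z| * |√x - √z| ≤ |√x - √z| * (√x + √z) := by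
        gcongr
        rw [abs_le]; constructor <;> linarith
    _ = |√x - √z| * |√x + √z| := by rw [abs_of_nonneg (by linarith : 0 ≤ √x + √z)]
    _ = |√x ^ 2 - √z ^ 2| := by rw [← abs_mul]; congr 1; ring
    _ = _ := by rw [h1, h2]

/-- Densities that differ by `δ` at one point `j ≥ 1` where both are at least `w`, agree at all
other points `1 ≤ y ≤ m`, and differ beyond `m` by a multiple of a Poisson profile are close in
Hellinger distance. At `y = 0` the difference is controlled since both densities have total
mass one. -/
theorem hellingerSq_le_of_localized {p q : PMF ℕ} {m j : ℕ} {δ w D : ℝ}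
    (hδ : 0 ≤ δ) (hw : 0 < w) (hD : 0 ≤ D)
    (hp0 : 1 / 2 ≤ (p 0).toReal) (hq0 : 1 / 2 ≤ (q 0).toReal)
    (hpj : w ≤ (p j).toReal) (hqj : w ≤ (q j).toReal)
    (hj : |(p j).toReal - (q j).toReal| ≤ δ)
    (hmid : ∀ y, 1 ≤ y → y ≤ m → y ≠ j → (p y).toReal = (q y).toReal)
    (htail : ∀ y, m < y → |(p y).toReal - (q y).toReal| ≤ D * ((m : ℝ) ^ y / y.factorial)) :
    hellingerSq p q ≤ ENNReal.ofReal
      ((δ + D * Real.exp m) ^ 2 / 2 + δ ^ 2 / (4 * w) + D * Real.exp m) := by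
  have hexp : HasSum (fun y : ℕ => D * ((m : ℝ) ^ y / y.factorial)) (D * Real.exp m) := by
    rw [Real.exp_eq_exp_ℝ]
    exact (NormedSpace.expSeries_div_hasSum_exp (m : ℝ)).mul_left D
  have hDm : ∀ y : ℕ, 0 ≤ D * ((m : ℝ) ^ y / y.factorial) := fun y => by positivity
  have hsum : ∀ r : PMF ℕ, HasSum (fun y => (r y).toReal) 1 := fun r => by
    have h := (ENNReal.hasSum_toReal (f := r) (by rw [r.tsum_coe]; simp))
    rwa [← ENNReal.tsum_toReal_eq r.apply_ne_top, r.tsum_coe, ENNReal.toReal_one] at h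
  have hbound : ∀ y, y ≠ 0 → |(p y).toReal - (q y).toReal| ≤
      (if y = j then δ else 0) + D * ((m : ℝ) ^ y / y.factorial) := by
    intro y hy
    have := hDm y
    by_cases hyj : y = j
    · subst hyj; simp only [if_true]; linarith
    · simp only [hyj, if_false, zero_add]
      rcases le_or_gt y m with h | h
      · rw [hmid y (by omega) h hyj, sub_self, abs_zero]; exact this
      · exact htail y h
  have h0 : |(p 0).toReal - (q 0).toReal| ≤ δ + D * Real.exp m := by
    have h1 := hasSum_ite_sub_hasSum ((hsum p).sub (hsum q)) 0
    have h2 : HasSum (fun y => (if y = j then δ else 0) + D * ((m : ℝ) ^ y / y.factorial))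
        (δ + D * Real.exp m) := (hasSum_ite_eq j δ).add hexp
    have h3 := tsum_of_norm_bounded h2 (f := fun y =>
      if y = 0 then 0 else (p y).toReal - (q y).toReal) (fun y => by
        by_cases hy : y = 0
        · subst hy
          have := hDm 0
          simp only [if_true, norm_zero]
          split_ifs <;> linarith
        · simp only [hy, if_false]
          exact hbound y hy)
    rw [h1.tsum_eq, Real.norm_eq_abs] at h3
    rw [abs_sub_comm]
    simpa using h3
  have hpt : ∀ y, (√(p y).toReal - √(q y).toReal) ^ 2 ≤
      (if y = 0 then (δ + D * Real.exp m) ^ 2 / 2 else 0) +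
        (if y = j then δ ^ 2 / (4 * w) else 0) + D * ((m : ℝ) ^ y / y.factorial) := by
    intro y
    have hn := hDm y
    have hA : 0 ≤ if y = 0 then (δ + D * Real.exp m) ^ 2 / 2 else 0 := by
      split_ifs <;> positivity
    have hB : 0 ≤ if y = j then δ ^ 2 / (4 * w) else 0 := by split_ifs <;> positivity
    by_cases hy : y = 0
    · have h1 := sq_sqrt_sub_sqrt_le_sq_div (by norm_num : (0 : ℝ) < 1 / 2) hp0 hq0
      have h2 := pow_le_pow_left₀ (abs_nonneg _) h0 2
      rw [sq_abs] at h2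
      subst hy
      rw [if_pos rfl]
      linarith
    · by_cases hyj : y = j
      · have h1 := sq_sqrt_sub_sqrt_le_sq_div hw hpj hqj
        have h2 : ((p j).toReal - (q j).toReal) ^ 2 / (4 * w) ≤ δ ^ 2 / (4 * w) := by
          have := pow_le_pow_left₀ (abs_nonneg _) hj 2
          rw [sq_abs] at this
          gcongr
        rw [if_pos hyj]
        rw [hyj] at hA hn ⊢
        linarith
      · have h1 := sq_sqrt_sub_sqrt_le_abs (ENNReal.toReal_nonneg (a := p y))
          (ENNReal.toReal_nonneg (a := q y))
        have h2 := hbound y hy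
        rw [if_neg hyj, zero_add] at h2
        linarith
  have htotal := ((hasSum_ite_eq 0 ((δ + D * Real.exp m) ^ 2 / 2)).add
    (hasSum_ite_eq j (δ ^ 2 / (4 * w)))).add hexp
  rw [hellingerSq, ← htotal.tsum_eq, ENNReal.ofReal_tsum_of_nonneg
    (fun y => (sq_nonneg _).trans (hpt y)) htotal.summable]
  exact ENNReal.tsum_le_tsum fun y => ENNReal.ofReal_le_ofReal (hpt y)

/-! ### A hypercube of priors with decoupled mixtures -/

/-- The values at `y ≥ 1` of the Poisson mixture with equal weights `6 ^ (-m)` at the points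
`k / b`, `1 ≤ k ≤ m`. -/
noncomputable def baseMixture (b : ℝ) (m y : ℕ) : ℝ :=
  ∑ k ∈ Finset.Icc 1 m, ((6 : ℝ) ^ m)⁻¹ *
    (Real.exp (-(b⁻¹ * k)) * (b⁻¹ * k) ^ y / y.factorial)

/-- The weight `6 ^ (-m)` at `k / b`, perturbed in the direction of dual weights `d` so that the
mixture moves by `τ i` at `y = i + 1`. The factor `exp (k / b)` cancels the one in the Poisson
density, and the powers of `b` undo the scaling of the nodes. -/
noncomputable def perturbedWeight (d : ℕ → ℕ → ℝ) (b : ℝ) (m : ℕ) {J : ℕ} (τ : Fin J → ℝ)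
    (k : ℕ) : ℝ :=
  ((6 : ℝ) ^ m)⁻¹ + Real.exp (b⁻¹ * k) * ∑ i, τ i * b ^ (i + 1 : ℕ) * d k (i + 1)

theorem sum_perturbedWeight_mul (d : ℕ → ℕ → ℝ) (b : ℝ) (m : ℕ) {J : ℕ} (τ : Fin J → ℝ) (y : ℕ) :
    ∑ k ∈ Finset.Icc 1 m, perturbedWeight d b m τ k *
        (Real.exp (-(b⁻¹ * k)) * (b⁻¹ * k) ^ y / y.factorial) =
      baseMixture b m y + ∑ i, τ i * b ^ (i + 1 : ℕ) * (b⁻¹) ^ y *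
        ∑ k ∈ Finset.Icc 1 m, d k (i + 1) * ((k : ℝ) ^ y / y.factorial) := by
  simp only [Finset.mul_sum]
  rw [Finset.sum_comm, baseMixture, ← Finset.sum_add_distrib]
  refine Finset.sum_congr rfl fun k _ => ?_
  rw [perturbedWeight, add_mul]
  congr 1
  rw [Finset.mul_sum, Finset.sum_mul]
  refine Finset.sum_congr rfl fun i _ => ?_
  rw [Real.exp_neg, mul_pow]
  have := (Real.exp_pos (b⁻¹ * k)).ne'
  field_simp

theorem exp_inv_mul_le {b : ℝ} (hb : 1 ≤ b) {k m : ℕ} (hk : k ≤ m) :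
    Real.exp (b⁻¹ * k) ≤ 3 ^ m := by
  refine le_trans (Real.exp_le_exp.2 ?_) (exp_natCast_le_three_pow m)
  have h1 : b⁻¹ ≤ 1 := inv_le_one_of_one_le₀ hb
  have h2 : (k : ℝ) ≤ m := by exact_mod_cast hk
  calc b⁻¹ * k ≤ 1 * k := by gcongr
    _ ≤ m := by linarith

/-- A lower bound for the base mixture, from the node `m / b` alone. -/
theorem le_baseMixture {b : ℝ} (hb : 1 ≤ b) {m J y : ℕ} (hm : 1 ≤ m) (hy : y ≤ J) (hJ : J ≤ m) :
    (18 ^ m * b ^ J)⁻¹ ≤ baseMixture b m y := by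
  have hb0 : 0 < b := by linarith
  have h1 : ((6 : ℝ) ^ m)⁻¹ * (Real.exp (-(b⁻¹ * m)) * (b⁻¹ * m) ^ y / y.factorial) ≤
      baseMixture b m y :=
    Finset.single_le_sum (f := fun k : ℕ => ((6 : ℝ) ^ m)⁻¹ *
      (Real.exp (-(b⁻¹ * k)) * (b⁻¹ * k) ^ y / y.factorial)) (fun k _ => by positivity)
      (Finset.mem_Icc.2 ⟨hm, le_rfl⟩)
  refine le_trans ?_ h1
  have h2 : ((3 : ℝ) ^ m)⁻¹ ≤ Real.exp (-(b⁻¹ * m)) := by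
    rw [Real.exp_neg]
    gcongr
    exact exp_inv_mul_le hb le_rfl
  have h3 : (y.factorial : ℝ) ≤ (m : ℝ) ^ y := by
    exact_mod_cast (Nat.factorial_le_pow y).trans (Nat.pow_le_pow_left (hy.trans hJ) y)
  have h4 : (b ^ J)⁻¹ ≤ (b⁻¹ * m) ^ y / y.factorial := by
    rw [le_div_iff₀ (by positivity), mul_pow, inv_pow]
    gcongr
  calc (18 ^ m * b ^ J)⁻¹ = ((6 : ℝ) ^ m)⁻¹ * (((3 : ℝ) ^ m)⁻¹ * (b ^ J)⁻¹) := by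
        rw [show (18 : ℝ) = 6 * 3 by norm_num, mul_pow]
        simp only [mul_inv]
        ring
    _ ≤ _ := by
        rw [mul_div_assoc]
        gcongr

theorem natCast_le_two_pow (m : ℕ) : (m : ℝ) ≤ 2 ^ m := by
  exact_mod_cast Nat.lt_two_pow_self.le

/-- If `432 ^ 8 ≤ b` and `b ^ (4 J) ≤ n ≤ b ^ (12 J)`, then the mixture values at `y = 1, …, J` can
be moved independently of each other, by up to `1 / (4 √n)`, by priors that put all but
exponentially small mass at the origin. The values at `J < y ≤ 8 J` do not move, and those at
`y > 8 J` move by an amount negligible against `1 / n`. -/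
theorem exists_decoupled_priors {b : ℝ} {J n : ℕ} (hb : 432 ^ 8 ≤ b) (hJ : 1 ≤ J)
    (hn₁ : b ^ (4 * J) ≤ n) (hn₂ : (n : ℝ) ≤ b ^ (12 * J)) :
    ∃ D : ℝ, 0 ≤ D ∧ D * Real.exp ((8 * J : ℕ) : ℝ) ≤ 1 / (8 * n) ∧
      (∀ y, y ≤ J → 1 / (n : ℝ) ≤ baseMixture b (8 * J) y) ∧
      ∀ τ : Fin J → ℝ, (∀ i, |τ i| ≤ 1 / (4 * √n)) → ∃ G : ProbabilityMeasure ℝ≥0,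
        (G : Measure ℝ≥0) {θ | (θ : ℝ) ≤ b⁻¹ * (8 * J : ℕ)} = 1 ∧
        (G : Measure ℝ≥0) {θ | 0 < (θ : ℝ)} ≤ ENNReal.ofReal (2 * (3 ^ (8 * J))⁻¹) ∧
        1 / 2 ≤ (mixture G 0).toReal ∧
        (∀ i : Fin J, (mixture G (i + 1)).toReal = baseMixture b (8 * J) (i + 1) + τ i) ∧
        (∀ y, J < y → y ≤ 8 * J → (mixture G y).toReal = baseMixture b (8 * J) y) ∧
        (∀ y, 8 * J < y → |(mixture G y).toReal - baseMixture b (8 * J) y| ≤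
          D * (((8 * J : ℕ) : ℝ) ^ y / y.factorial)) := by
  have hb1 : 1 ≤ b := le_trans (by norm_num) hb
  have hb0 : 0 < b := by linarith
  have hn0 : (0 : ℝ) < n := lt_of_lt_of_le (by positivity) hn₁
  set K : ℝ := √n with hK
  have hK0 : 0 < K := Real.sqrt_pos.2 hn0
  have hKn : K ^ 2 = n := Real.sq_sqrt hn0.le
  have hn1 : (1 : ℝ) ≤ n := by exact_mod_cast Nat.one_le_iff_ne_zero.2 (by rintro rfl; simp at hn0)
  have hK1 : 1 ≤ K := by rw [hK]; exact Real.one_le_sqrt.2 hn1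
  set m : ℕ := 8 * J with hm
  have hm1 : 1 ≤ m := by omega
  have hJm : J ≤ m := by omega
  have hsq : (432 ^ m * b ^ J) ^ 2 ≤ b ^ (4 * J) := by
    have h1 : ((432 : ℝ) ^ m) ^ 2 ≤ b ^ (2 * J) := by
      rw [hm, ← pow_mul, show 8 * J * 2 = 8 * (2 * J) by ring, pow_mul]
      exact pow_le_pow_left₀ (by norm_num) hb _
    calc (432 ^ m * b ^ J) ^ 2 = ((432 : ℝ) ^ m) ^ 2 * b ^ (2 * J) := by
          rw [mul_pow, ← pow_mul b J 2, mul_comm J 2]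
      _ ≤ b ^ (2 * J) * b ^ (2 * J) := by gcongr
      _ = b ^ (4 * J) := by rw [← pow_add]; congr 1; ring
  have hA : 432 ^ m * b ^ J ≤ K := by
    refine le_of_sq_le_sq ?_ hK0.le
    rw [hKn]; exact hsq.trans hn₁
  have hB : 432 ^ m * b ^ J * K ≤ b ^ m := by
    refine le_of_sq_le_sq ?_ (by positivity)
    rw [mul_pow, hKn]
    calc (432 ^ m * b ^ J) ^ 2 * n ≤ b ^ (4 * J) * b ^ (12 * J) := by gcongr
      _ = (b ^ m) ^ 2 := by rw [← pow_add, ← pow_mul, hm]; congr 1; ring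
  have hJ2 : (J : ℝ) ≤ 2 ^ m :=
    le_trans (by exact_mod_cast hJm) (natCast_le_two_pow m)
  have hm2 := natCast_le_two_pow m
  obtain ⟨d, hd, hdual⟩ := exists_dual_weights hm1
  set t : ℝ := 1 / (4 * K) with ht
  have ht0 : 0 ≤ t := by positivity
  refine ⟨t * b ^ J * 48 ^ m / b ^ m, by positivity, ?_, ?_, ?_⟩
  · have h2 : (2 : ℝ) ≤ 2 ^ m := by
      simpa using pow_le_pow_right₀ (by norm_num : (1 : ℝ) ≤ 2) hm1
    have h3 : (2 : ℝ) * (48 ^ m * Real.exp m) ≤ 432 ^ m := by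
      calc (2 : ℝ) * (48 ^ m * Real.exp m) ≤ 2 ^ m * (48 ^ m * 3 ^ m) := by
            gcongr; exact exp_natCast_le_three_pow m
        _ = 288 ^ m := by rw [← mul_pow, ← mul_pow]; norm_num
        _ ≤ _ := by gcongr; norm_num
    have h4 : b ^ J * (48 ^ m * Real.exp m) / b ^ m ≤ 1 / (2 * K) := by
      rw [div_le_div_iff₀ (by positivity) (by positivity)]
      calc b ^ J * (48 ^ m * Real.exp m) * (2 * K) = (2 * (48 ^ m * Real.exp m)) * b ^ J * K := by
            ring
        _ ≤ 432 ^ m * b ^ J * K := by gcongr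
        _ ≤ _ := by linarith
    calc t * b ^ J * 48 ^ m / b ^ m * Real.exp m
        = t * (b ^ J * (48 ^ m * Real.exp m) / b ^ m) := by ring
      _ ≤ t * (1 / (2 * K)) := by gcongr
      _ = 1 / (8 * n) := by rw [ht, ← hKn]; field_simp; norm_num
  · intro y hy
    refine le_trans ?_ (le_baseMixture hb1 hm1 hy hJm)
    rw [one_div]
    gcongr
    calc (18 : ℝ) ^ m * b ^ J ≤ 432 ^ m * b ^ J := by gcongr; norm_num
      _ ≤ K := hA
      _ ≤ K ^ 2 := by nlinarith
      _ = n := hKn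
  · intro τ hτ
    have hdk : ∀ k ∈ Finset.Icc 1 m, ∀ i : Fin J, |d k (i + 1)| ≤ 12 ^ m := fun k hk i =>
      hd k (i + 1) (Finset.mem_Icc.1 hk).2 (by have := i.2; omega)
    -- The perturbation of each weight is at most the weight itself.
    have hpert : ∀ k ∈ Finset.Icc 1 m,
        |Real.exp (b⁻¹ * k) * ∑ i, τ i * b ^ (i + 1 : ℕ) * d k (i + 1)| ≤ ((6 : ℝ) ^ m)⁻¹ := by
      intro k hk
      have h1 : |∑ i, τ i * b ^ (i + 1 : ℕ) * d k (i + 1)| ≤ J * (t * b ^ J * 12 ^ m) := by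
        refine (Finset.abs_sum_le_sum_abs _ _).trans ?_
        calc _ ≤ ∑ _i : Fin J, t * b ^ J * 12 ^ m := by
              refine Finset.sum_le_sum fun i _ => ?_
              rw [abs_mul, abs_mul, abs_of_nonneg (pow_nonneg hb0.le (i + 1 : ℕ))]
              gcongr
              · exact hτ i
              · exact i.2
              · exact hdk k hk i
          _ = _ := by simp
      rw [abs_mul, abs_of_pos (Real.exp_pos _), ← one_div ((6 : ℝ) ^ m), le_div_iff₀ (by positivity)]
      calc Real.exp (b⁻¹ * k) * |∑ i, τ i * b ^ (i + 1 : ℕ) * d k (i + 1)| * 6 ^ m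
          ≤ 3 ^ m * (2 ^ m * (t * b ^ J * 12 ^ m)) * 6 ^ m := by
            gcongr
            · exact exp_inv_mul_le hb1 (Finset.mem_Icc.1 hk).2
            · exact h1.trans (by gcongr)
        _ = t * (((3 : ℝ) ^ m * 2 ^ m * 12 ^ m * 6 ^ m) * b ^ J) := by ring
        _ = t * (432 ^ m * b ^ J) := by simp only [← mul_pow]; norm_num
        _ ≤ t * K := by gcongr
        _ = 1 / 4 := by rw [ht]; field_simp
        _ ≤ 1 := by norm_num
    have hc0 : ∀ k ∈ Finset.Icc 1 m, 0 ≤ perturbedWeight d b m τ k := fun k hk => by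
      have := neg_le_of_abs_le (hpert k hk)
      rw [perturbedWeight]; linarith
    have hcs : ∑ k ∈ Finset.Icc 1 m, perturbedWeight d b m τ k ≤ 2 * (3 ^ m)⁻¹ := by
      calc ∑ k ∈ Finset.Icc 1 m, perturbedWeight d b m τ k
          ≤ ∑ _k ∈ Finset.Icc 1 m, 2 * ((6 : ℝ) ^ m)⁻¹ := by
            refine Finset.sum_le_sum fun k hk => ?_
            have := le_of_abs_le (hpert k hk)
            rw [perturbedWeight]; linarith
        _ = m * (2 * ((6 : ℝ) ^ m)⁻¹) := by simp
        _ ≤ 2 ^ m * (2 * ((6 : ℝ) ^ m)⁻¹) := by gcongr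
        _ = 2 * (3 ^ m)⁻¹ := by
            rw [show (6 : ℝ) = 2 * 3 by norm_num, mul_pow]; field_simp
    have h3m : 2 * ((3 : ℝ) ^ m)⁻¹ ≤ 1 / 2 := by
      have : (3 : ℝ) ^ 2 ≤ 3 ^ m := pow_le_pow_right₀ (by norm_num) (by omega)
      rw [← div_eq_mul_inv, div_le_iff₀ (by positivity)]
      linarith
    obtain ⟨G, hG1, hG2, hG3, hG4⟩ := exists_lattice_prior (inv_nonneg.2 hb0.le) m
      (perturbedWeight d b m τ) hc0 (by linarith)
    have hval : ∀ y, 1 ≤ y → (mixture G y).toReal = baseMixture b m y +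
        ∑ i, τ i * b ^ (i + 1 : ℕ) * (b⁻¹) ^ y *
          ∑ k ∈ Finset.Icc 1 m, d k (i + 1) * ((k : ℝ) ^ y / y.factorial) := fun y hy => by
      rw [hG4 y hy, sum_perturbedWeight_mul]
    refine ⟨G, hG1, hG2.trans (ENNReal.ofReal_le_ofReal hcs), by linarith, ?_, ?_, ?_⟩
    · intro i
      rw [hval _ (by omega), Finset.sum_eq_single i]
      · rw [hdual _ _ (by omega) (by have := i.2; omega), if_pos rfl, inv_pow]
        field_simp
      · intro i' _ hne
        rw [hdual _ _ (by omega) (by have := i.2; omega), if_neg, mul_zero]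
        intro h
        exact hne (Fin.ext (by omega))
      · simp
    · intro y hy hym
      rw [hval y (by omega), Finset.sum_eq_zero, add_zero]
      intro i _
      rw [hdual _ _ (by omega) hym, if_neg (by have := i.2; omega), mul_zero]
    · intro y hy
      rw [hval y (by omega), add_sub_cancel_left]
      refine (Finset.abs_sum_le_sum_abs _ _).trans ?_
      have h1 : ∀ i : Fin J,
          |∑ k ∈ Finset.Icc 1 m, d k (i + 1) * ((k : ℝ) ^ y / y.factorial)| ≤
            m * (12 ^ m * ((m : ℝ) ^ y / y.factorial)) := by
        intro i
        refine (Finset.abs_sum_le_sum_abs _ _).trans ?_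
        calc _ ≤ ∑ _k ∈ Finset.Icc 1 m, 12 ^ m * ((m : ℝ) ^ y / y.factorial) := by
              refine Finset.sum_le_sum fun k hk => ?_
              have hkm : (k : ℝ) ≤ m := by exact_mod_cast (Finset.mem_Icc.1 hk).2
              rw [abs_mul, abs_of_nonneg (by positivity : (0 : ℝ) ≤ (k : ℝ) ^ y / y.factorial)]
              gcongr
              exact hdk k hk i
          _ = _ := by simp
      have h2 : (b⁻¹) ^ y ≤ (b ^ m)⁻¹ := by
        rw [inv_pow]
        gcongr
      calc _ ≤ ∑ _i : Fin J, t * b ^ J * (b ^ m)⁻¹ *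
            (2 ^ m * (12 ^ m * ((m : ℝ) ^ y / y.factorial))) := by
            refine Finset.sum_le_sum fun i _ => ?_
            rw [abs_mul, abs_mul, abs_mul, abs_of_nonneg (pow_nonneg hb0.le (i + 1 : ℕ)),
              abs_of_nonneg (by positivity : (0 : ℝ) ≤ (b⁻¹) ^ y)]
            gcongr
            · exact hτ i
            · exact i.2
            · exact (h1 i).trans (by gcongr)
        _ = J * (t * b ^ J * (b ^ m)⁻¹ *
            (2 ^ m * (12 ^ m * ((m : ℝ) ^ y / y.factorial)))) := by simp
        _ ≤ 2 ^ m * (t * b ^ J * (b ^ m)⁻¹ *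
            (2 ^ m * (12 ^ m * ((m : ℝ) ^ y / y.factorial)))) := by gcongr
        _ = t * b ^ J * ((2 : ℝ) ^ m * 2 ^ m * 12 ^ m) / b ^ m * ((m : ℝ) ^ y / y.factorial) := by
            ring
        _ = _ := by simp only [← mul_pow]; norm_num

/-! ### The minimax lower bounds -/

theorem sq_div_le_sq_sqrt_sub_sqrt {x δ : ℝ} (hx : 0 < x) (hδ : 0 ≤ δ) (hδx : δ ≤ x) :
    δ ^ 2 / (6 * x) ≤ (√(x + δ) - √x) ^ 2 := by
  rw [div_le_iff₀ (by positivity)]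
  have h1 := Real.sq_sqrt hx.le
  have h2 := Real.sq_sqrt (by linarith : 0 ≤ x + δ)
  have h3 : (√(x + δ) + √x) ^ 2 ≤ 6 * x := by nlinarith [sq_nonneg (√(x + δ) - √x)]
  calc δ ^ 2 = (√(x + δ) ^ 2 - √x ^ 2) ^ 2 := by rw [h1, h2]; ring
    _ = (√(x + δ) - √x) ^ 2 * (√(x + δ) + √x) ^ 2 := by ring
    _ ≤ _ := by gcongr

/-- A class of priors that contains every distribution on `[0, 8 J / b]` with all but
exponentially small mass at the origin has minimax risk at least of order `J / n`. -/
theorem le_minimaxRisk {b : ℝ} {J n : ℕ} (hb : 432 ^ 8 ≤ b) (hJ : 1 ≤ J)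
    (hn₁ : b ^ (4 * J) ≤ n) (hn₂ : (n : ℝ) ≤ b ^ (12 * J)) (𝒢 : Set (ProbabilityMeasure ℝ≥0))
    (h𝒢 : ∀ G : ProbabilityMeasure ℝ≥0,
      (G : Measure ℝ≥0) {θ | (θ : ℝ) ≤ b⁻¹ * (8 * J : ℕ)} = 1 →
      (G : Measure ℝ≥0) {θ | 0 < (θ : ℝ)} ≤ ENNReal.ofReal (2 * (3 ^ (8 * J))⁻¹) → G ∈ 𝒢) :
    ENNReal.ofReal (J / (3072 * n)) ≤ minimaxRisk n 𝒢 := by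
  have hb0 : 0 < b := lt_of_lt_of_le (by norm_num) hb
  have hn0 : (0 : ℝ) < n := lt_of_lt_of_le (by positivity) hn₁
  have hnn : 1 ≤ n := Nat.one_le_iff_ne_zero.2 (by rintro rfl; simp at hn0)
  have hn1 : (1 : ℝ) ≤ n := by exact_mod_cast hnn
  obtain ⟨D, hD0, hD, hF, hG⟩ := exists_decoupled_priors hb hJ hn₁ hn₂
  set F : ℕ → ℝ := baseMixture b (8 * J)
  set K : ℝ := √n with hK
  have hK0 : 0 < K := Real.sqrt_pos.2 hn0
  have hKn : K ^ 2 = n := Real.sq_sqrt hn0.le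
  have hK1 : 1 ≤ K := Real.one_le_sqrt.2 hn1
  have hFpos : ∀ i : Fin J, 0 < F (i + 1) := fun i =>
    lt_of_lt_of_le (by positivity) (hF (i + 1) (by have := i.2; omega))
  have hF1 : ∀ i : Fin J, F (i + 1) ≤ 1 := fun i => by
    obtain ⟨G, -, -, -, h, -⟩ := hG 0 fun i => by simp [hK0.le]
    have h1 := h i
    rw [Pi.zero_apply, add_zero] at h1
    rw [← h1]
    exact ENNReal.toReal_le_of_le_ofReal zero_le_one (by simpa using PMF.coe_le_one _ _)
  -- The size of the `i`-th perturbation, such that it contributes order `1 / n` to the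
  -- chi-square distance.
  set δ : Fin J → ℝ := fun i => √(F (i + 1)) / (4 * K) with hδ
  have hδ0 : ∀ i, 0 ≤ δ i := fun i => div_nonneg (Real.sqrt_nonneg _) (by positivity)
  have hδt : ∀ i, δ i ≤ 1 / (4 * K) := fun i => by
    simp only [hδ]
    gcongr
    exact Real.sqrt_le_one.2 (hF1 i)
  have hδsq : ∀ i, δ i ^ 2 = F (i + 1) / (16 * n) := fun i => by
    simp only [hδ]
    rw [div_pow, Real.sq_sqrt (hFpos i).le, mul_pow, hKn]
    norm_num
  have hδF : ∀ i, δ i ≤ F (i + 1) := fun i => by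
    refine le_of_sq_le_sq ?_ (hFpos i).le
    have h1 := hF (i + 1) (by have := i.2; omega)
    rw [hδsq, div_le_iff₀ (by positivity)]
    rw [div_le_iff₀ hn0] at h1
    have h2 := hFpos i
    nlinarith
  set τ : (Fin J → Bool) → Fin J → ℝ := fun u i => if u i then δ i else 0 with hτ
  have hτ0 : ∀ u i, 0 ≤ τ u i := fun u i => by
    simp only [hτ]; split_ifs; exacts [hδ0 i, le_rfl]
  have hτt : ∀ u i, |τ u i| ≤ 1 / (4 * K) := fun u i => by
    rw [abs_of_nonneg (hτ0 u i)]
    simp only [hτ]; split_ifs; exacts [hδt i, by positivity]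
  choose G hsupp hmass hzero hlow hmid htail using fun u => hG (τ u) (hτt u)
  have hflip : ∀ u i, (τ u i = δ i ∧ τ (flipAt u i) i = 0) ∨
      (τ u i = 0 ∧ τ (flipAt u i) i = δ i) := fun u i => by
    simp only [hτ, flipAt, Function.update_self]
    cases u i <;> simp
  have hsame : ∀ u i i', i' ≠ i → τ (flipAt u i) i' = τ u i' := fun u i i' h => by
    simp only [hτ, flipAt, Function.update_of_ne h]
  have hclose : ∀ u i, hellingerSq (mixture (G u)) (mixture (G (flipAt u i))) ≤
      ENNReal.ofReal (1 / n) := by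
    intro u i
    have hle : ∀ v, F (i + 1) ≤ (mixture (G v) (i + 1)).toReal := fun v => by
      rw [hlow]; linarith [hτ0 v i]
    refine (hellingerSq_le_of_localized (m := 8 * J) (j := i + 1) (D := 2 * D) (hδ0 i) (hFpos i)
      (by positivity) (hzero u) (hzero _) (hle u) (hle _) ?_ ?_ ?_).trans ?_
    · rw [hlow, hlow]
      have := hδ0 i
      rcases hflip u i with ⟨h1, h2⟩ | ⟨h1, h2⟩ <;> rw [h1, h2]
      · rw [show F (i + 1) + δ i - (F (i + 1) + 0) = δ i by ring, abs_of_nonneg this]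
      · rw [show F (i + 1) + 0 - (F (i + 1) + δ i) = -δ i by ring, abs_neg, abs_of_nonneg this]
    · intro y hy1 hym hyi
      rcases le_or_gt y J with h | h
      · obtain ⟨i', rfl⟩ : ∃ i' : Fin J, y = i' + 1 := ⟨⟨y - 1, by omega⟩, by simp; omega⟩
        rw [hlow, hlow, hsame u i i' (by rintro rfl; exact hyi rfl)]
      · rw [hmid _ y h hym, hmid _ y h hym]
    · intro y hy
      have h1 := htail u y hy
      have h2 := htail (flipAt u i) y hy
      rw [abs_sub_comm] at h2
      have h3 := abs_sub_le (mixture (G u) y).toReal (F y) (mixture (G (flipAt u i)) y).toReal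
      linarith
    · apply ENNReal.ofReal_le_ofReal
      have h1 : δ i ^ 2 / (4 * F (i + 1)) = 1 / (64 * n) := by
        have := (hFpos i).ne'
        rw [hδsq]; field_simp; norm_num
      have h2 : 2 * D * Real.exp ((8 * J : ℕ) : ℝ) ≤ 1 / (4 * n) := by
        calc _ = 2 * (D * Real.exp ((8 * J : ℕ) : ℝ)) := by ring
          _ ≤ 2 * (1 / (8 * n)) := by gcongr
          _ = _ := by field_simp; norm_num
      have h3 : (1 : ℝ) / (4 * n) ≤ 1 / (4 * K) := by
        rw [← hKn]
        gcongr
        nlinarith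
      have h4 : (δ i + 2 * D * Real.exp ((8 * J : ℕ) : ℝ)) ^ 2 ≤ (1 / (2 * K)) ^ 2 := by
        have h5 : (1 : ℝ) / (2 * K) = 1 / (4 * K) + 1 / (4 * K) := by field_simp; norm_num
        have := hδ0 i
        refine pow_le_pow_left₀ (by positivity) ?_ 2
        linarith [hδt i]
      have h6 : (1 / (2 * K)) ^ 2 = 1 / (4 * n) := by rw [← hKn]; field_simp; norm_num
      rw [h6] at h4
      rw [h1]
      have e : ∀ c : ℝ, 1 / (c * n) = 1 / c * (1 / n) := fun c => by rw [one_div_mul_one_div]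
      rw [e] at h2 h4 ⊢
      have : 0 ≤ 1 / (n : ℝ) := by positivity
      linarith
  have hsep : ∀ (u : Fin J → Bool) (i : Fin J), 1 / (96 * n : ℝ) ≤ (√(mixture (G u) (i + 1)).toReal -
      √(mixture (G (flipAt u i)) (i + 1)).toReal) ^ 2 := by
    intro u i
    have h1 := sq_div_le_sq_sqrt_sub_sqrt (hFpos i) (hδ0 i) (hδF i)
    have h2 : δ i ^ 2 / (6 * F (i + 1)) = 1 / (96 * n) := by
      have := (hFpos i).ne'
      rw [hδsq]; field_simp; norm_num
    rw [h2] at h1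
    rw [hlow, hlow]
    rcases hflip u i with ⟨h3, h4⟩ | ⟨h3, h4⟩ <;> rw [h3, h4, add_zero]
    · exact h1
    · rwa [← neg_sub, neg_sq]
  rw [minimaxRisk]
  refine le_iInf fun f => ?_
  have hA := assouad_hellinger (ε := 1 / (96 * n)) hnn (fun u => mixture (G u)) (y := fun i : Fin J => (i : ℕ) + 1)
    (fun i i' h => Fin.ext (by simpa using h)) (by positivity) hclose hsep f
  rw [show (J : ℝ) * (1 / (96 * n)) / 32 = J / (3072 * n) by field_simp; norm_num] at hA
  refine hA.trans (iSup_le fun u => ?_)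
  exact le_iSup₂ (f := fun (G : ProbabilityMeasure ℝ≥0) (_ : G ∈ 𝒢) =>
    ∫⁻ Y, hellingerSq (mixture G) (f Y) ∂(sampleLaw n G)) (G u) (h𝒢 _ (hsupp u) (hmass u))

/-- The choice `J = ⌊log n / (4 log b)⌋` in the lower bound. -/
theorem log_div_log_le_minimaxRisk {b : ℝ} {n : ℕ} (hb : 432 ^ 8 ≤ b) (hn : b ^ 4 ≤ n)
    (𝒢 : Set (ProbabilityMeasure ℝ≥0))
    (h𝒢 : ∀ J : ℕ, 4 * J * Real.log b ≤ Real.log n → ∀ G : ProbabilityMeasure ℝ≥0,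
      (G : Measure ℝ≥0) {θ | (θ : ℝ) ≤ b⁻¹ * (8 * J : ℕ)} = 1 →
      (G : Measure ℝ≥0) {θ | 0 < (θ : ℝ)} ≤ ENNReal.ofReal (2 * (3 ^ (8 * J))⁻¹) → G ∈ 𝒢) :
    ENNReal.ofReal (1 / 24576 / n * (Real.log n / Real.log b)) ≤ minimaxRisk n 𝒢 := by
  have hb1 : 1 < b := lt_of_lt_of_le (by norm_num) hb
  have hb0 : 0 < b := by linarith
  have hn0 : (0 : ℝ) < n := lt_of_lt_of_le (by positivity) hn
  have hL : 0 < Real.log b := Real.log_pos hb1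
  have hlog4 : 4 * Real.log b ≤ Real.log n := by
    have := Real.log_le_log (by positivity) hn
    rwa [Real.log_pow] at this
  set x : ℝ := Real.log n / (4 * Real.log b) with hx
  have hx1 : 1 ≤ x := by rw [hx, le_div_iff₀ (by positivity)]; linarith
  set J : ℕ := ⌊x⌋₊ with hJ
  have hJ1 : 1 ≤ J := Nat.le_floor (by exact_mod_cast hx1)
  have hJ1' : (1 : ℝ) ≤ J := by exact_mod_cast hJ1
  have hJx : (J : ℝ) ≤ x := Nat.floor_le (by linarith)
  have hxJ : x < J + 1 := Nat.lt_floor_add_one x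
  have hlogn : Real.log n = x * (4 * Real.log b) := by rw [hx]; field_simp
  have hn₁ : b ^ (4 * J) ≤ n := by
    rw [← Real.log_le_log_iff (by positivity) hn0, Real.log_pow, hlogn]
    push_cast
    nlinarith
  have hn₂ : (n : ℝ) ≤ b ^ (12 * J) := by
    rw [← Real.log_le_log_iff hn0 (by positivity), Real.log_pow, hlogn]
    push_cast
    nlinarith
  refine le_trans (ENNReal.ofReal_le_ofReal ?_) (le_minimaxRisk hb hJ1 hn₁ hn₂ 𝒢
    (h𝒢 J (by rw [hlogn]; nlinarith)))
  have h1 : Real.log n / Real.log b = 4 * x := by rw [hlogn]; field_simp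
  rw [h1, show (1 : ℝ) / 24576 / n * (4 * x) = (x / 2) / (3072 * n) by field_simp; norm_num]
  gcongr
  linarith

end PoissonMixture

theorem mainTheorem7 :
    (∀ h : ℝ, 0 < h → ∃ c₀ : ℝ, 0 < c₀ ∧ ∃ n₀ : ℕ, ∀ n : ℕ, n₀ ≤ n →
      ENNReal.ofReal (c₀ / n * (Real.log n / Real.log (Real.log n))) ≤
        PoissonMixture.minimaxRisk n (PoissonMixture.priorsOnIcc h)) ∧
    (∀ s : ℝ, 0 < s → ∃ c₁ : ℝ, 0 < c₁ ∧ ∃ n₀ : ℕ, ∀ n : ℕ, n₀ ≤ n →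
      ENNReal.ofReal (c₁ / n * Real.log n) ≤
        PoissonMixture.minimaxRisk n (PoissonMixture.subExp s)) := by
  constructor
  · intro h hh
    refine ⟨1 / 24576, by norm_num, ?_⟩
    have hlog : Filter.Tendsto (fun n : ℕ => Real.log n) Filter.atTop Filter.atTop :=
      Real.tendsto_log_atTop.comp tendsto_natCast_atTop_atTop
    have hloglog := Real.tendsto_log_atTop.comp hlog
    have hpow : ∀ᶠ n : ℕ in Filter.atTop, Real.log n ^ 4 ≤ n := by
      have h1 := (Real.isLittleO_pow_log_id_atTop (n := 4)).bound (zero_lt_one' ℝ)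
      filter_upwards [tendsto_natCast_atTop_atTop.eventually h1] with n hn
      exact (le_abs_self _).trans (by simpa using hn)
    obtain ⟨n₀, hn₀⟩ := Filter.eventually_atTop.1
      ((hlog.eventually_ge_atTop (432 ^ 8)).and
        ((hloglog.eventually_ge_atTop (2 / h)).and hpow))
    refine ⟨n₀, fun n hn => ?_⟩
    obtain ⟨h1, h2, h3⟩ := hn₀ n hn
    refine PoissonMixture.log_div_log_le_minimaxRisk h1 h3 _ fun J hJ G hG _ => ?_
    -- With `b = log n` the support bound `8 J / b` is at most `2 / log log n ≤ h`.
    have hb0 : 0 < Real.log n := lt_of_lt_of_le (by norm_num) h1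
    refine le_antisymm prob_le_one (hG.symm.le.trans (measure_mono fun θ hθ => ?_))
    refine le_trans (show (θ : ℝ) ≤ _ from hθ) ?_
    rw [inv_mul_le_iff₀ hb0]
    push_cast
    simp only [Function.comp_apply] at h2
    rw [div_le_iff₀ hh] at h2
    have hJ0 : (0 : ℝ) ≤ J := by positivity
    nlinarith
  · intro s hs
    set b : ℝ := max (432 ^ 8) (1 / s) with hb
    have hb1 : 432 ^ 8 ≤ b := le_max_left _ _
    have hbs : 1 / s ≤ b := le_max_right _ _
    have hb0 : 0 < b := lt_of_lt_of_le (by norm_num) hb1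
    have hL : 0 < Real.log b := Real.log_pos (lt_of_lt_of_le (by norm_num) hb1)
    refine ⟨1 / 24576 / Real.log b, by positivity, ⌈b ^ 4⌉₊, fun n hn => ?_⟩
    have hn' : b ^ 4 ≤ n := (Nat.le_ceil _).trans (by exact_mod_cast hn)
    rw [show 1 / 24576 / Real.log b / n * Real.log n =
      1 / 24576 / n * (Real.log n / Real.log b) by ring]
    refine PoissonMixture.log_div_log_le_minimaxRisk hb1 hn' _ fun J _ G hG hmass t ht => ?_
    rcases lt_or_ge (b⁻¹ * (8 * J : ℕ)) t with h | h
    · have h0 : (G : Measure ℝ≥0) {θ | t ≤ (θ : ℝ)} = 0 := by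
        refine measure_mono_null (t := {θ : ℝ≥0 | (θ : ℝ) ≤ b⁻¹ * (8 * J : ℕ)}ᶜ)
          (fun θ hθ => not_le.2 (h.trans_le hθ)) ?_
        rwa [prob_compl_eq_zero_iff (measurableSet_le (by fun_prop) (by fun_prop))]
      rw [h0]
      exact zero_le
    · refine (measure_mono fun θ hθ => lt_of_lt_of_le ht hθ).trans
        (hmass.trans (ENNReal.ofReal_le_ofReal ?_))
      have h1 : t / s ≤ (8 * J : ℕ) := by
        rw [inv_mul_eq_div, le_div_iff₀ hb0] at h
        calc t / s = t * (1 / s) := by ring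
          _ ≤ t * b := by gcongr
          _ ≤ _ := h
      rw [neg_div, Real.exp_neg]
      gcongr
      exact (Real.exp_le_exp.2 h1).trans (PoissonMixture.exp_natCast_le_three_pow _)
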